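/- Let $D$ be the canonical (minimal) Scott domain solving the recursive domain equation $$D = (\mathbf{Nil} + \mathbf{Left}(D) + \mathbf{Right}(D) + \mathbf{Pair}(D\times D) + \mathbf{Fun}(D\to D))_\bot ,$$ where $D\to D$ is the domain of Scott-continuous functions, $+$ is the disjoint sum of partial orders and $(\cdot)_\bot$ adds a new least element $\bot$. A *subdomain* of $D$ is a subset of $D$ that is downwards closed and closed under suprema of bounded subsets. *Types* are given by the grammar $\rho,\sigma ::= \alpha \mid \mathbf{1} \mid \rho+\sigma \mid \rho\times\sigma \mid \rho\Rightarrow\sigma \mid \mathbf{fix}\,\alpha.\rho$, where $\alpha$ ranges over type variables and in $\mathbf{fix}\,\alpha.\rho$ the type $\rho$ must be strictly positive in $\alpha$, that is, no free occurrence of $\alpha$ in $\rho$ is within the left-hand side of a function type $\sigma\Rightarrow\tau$. For an environment $\zeta$ assigning a subdomain of $D$ to each type variable, every type $\rho$ denotes a subdomain $[\![\rho]\!]_\zeta$ of $D$: $$[\![\alpha]\!]_\zeta=\zeta(\alpha),\qquad [\![\mathbf 1]\!]_\zeta=\{\mathbf{Nil},\bot\},$$ $$[\![\rho+\sigma]\!]_\zeta=\{\mathbf{Left}(a)\mid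 a\in[\![\rho]\!]_\zeta\}\cup\{\mathbf{Right}(b)\mid b\in[\![\sigma]\!]_\zeta\}\cup\{\bot\},$$ $$[\![\rho\times\sigma]\!]_\zeta=\{\mathbf{Pair}(a,b)\mid a\in[\![\rho]\!]_\zeta,\ b\in[\![\sigma]\!]_\zeta\}\cup\{\bot\},$$ $$[\![\rho\Rightarrow\sigma]\!]_\zeta=\{\mathbf{Fun}(f)\mid f:D\to D\text{ continuous},\ f(a)\in[\![\sigma]\!]_\zeta\text{ for all }a\in[\![\rho]\!]_\zeta\}\cup\{\bot\},$$ $$[\![\mathbf{fix}\,\alpha.\rho]\!]_\zeta=\bigcap\{X \mid X\text{ a subdomain of }D,\ [\![\rho]\!]_{\zeta[\alpha\mapsto X]}\subseteq X\}.$$ A type is *regular* if it has no subexpression of the form $\mathbf{fix}\,\alpha.\mathbf{fix}\,\beta_1.\ldots\mathbf{fix}\,\beta_n.\alpha$ with $n\ge 0$ and all $\beta_i$ different from $\alpha$. **Theorem (Uniqueness of fixed points).** Let $\mathbf{fix}\,\alpha.\rho$ be a regular type, $\zeta$ an environment and $X$ a subdomain of $D$. 1. If $X\subseteq[\![\rho]\!]_{\zeta[\alpha\mapsto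 X]}$, then $X\subseteq[\![\mathbf{fix}\,\alpha.\rho]\!]_\zeta$. 2. If $[\![\rho]\!]_{\zeta[\alpha\mapsto X]}\subseteq X$, then $[\![\mathbf{fix}\,\alpha.\rho]\!]_\zeta\subseteq X$. 3. Hence $X=[\![\rho]\!]_{\zeta[\alpha\mapsto X]}$ if and only if $X=[\![\mathbf{fix}\,\alpha.\rho]\!]_\zeta$. -/

import Mathlib

namespace Realizers

/-- The summands of the domain equation, with a new least element: the lifted disjoint sum
`(Nil + Left(A) + Right(A) + Pair(A × A) + Fun(C))_⊥`. -/
inductive Step (A C : Type) : Type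
  | bot : Step A C
  | nil : Step A C
  | left (a : A) : Step A C
  | right (a : A) : Step A C
  | pair (a b : A) : Step A C
  | fn (f : C) : Step A C

namespace Step

variable {A C : Type}

/-- The order of the lifted disjoint sum. -/
inductive Le [LE A] [LE C] : Step A C → Step A C → Prop
  | bot (x : Step A C) : Le Step.bot x
  | nil : Le Step.nil Step.nil
  | left {a a' : A} : a ≤ a' → Le (Step.left a) (Step.left a')
  | right {a a' : A} : a ≤ a' → Le (Step.right a) (Step.right a')
  | pair {a a' b b' : A} : a ≤ a' → b ≤ b' → Le (Step.pair a b) (Step.pair a' b')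
  | fn {f f' : C} : f ≤ f' → Le (Step.fn f) (Step.fn f')

instance [PartialOrder A] [PartialOrder C] : PartialOrder (Step A C) where
  le := Le
  le_refl x := by cases x <;> constructor <;> exact le_rfl
  le_trans x y z h k := by
    cases h <;> cases k <;> constructor <;> (first | assumption | (apply le_trans <;> assumption))
  le_antisymm x y h k := by
    cases h <;> cases k <;> first | rfl | (congr 1 <;> apply le_antisymm <;> assumption)

instance [PartialOrder A] [PartialOrder C] : OrderBot (Step A C) where
  bot := Step.bot
  bot_le := Le.bot

instance [SemilatticeInf A] [SemilatticeInf C] : SemilatticeInf (Step A C) where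
  inf
    | .nil, .nil => .nil
    | .left a, .left a' => .left (a ⊓ a')
    | .right a, .right a' => .right (a ⊓ a')
    | .pair a b, .pair a' b' => .pair (a ⊓ a') (b ⊓ b')
    | .fn f, .fn f' => .fn (f ⊓ f')
    | _, _ => .bot
  inf_le_left x y := by
    cases x <;> cases y <;> constructor <;> exact inf_le_left
  inf_le_right x y := by
    cases x <;> cases y <;> constructor <;> exact inf_le_right
  le_inf x y z h k := by
    cases h <;> cases k <;> constructor <;> (first | assumption | (apply le_inf <;> assumption))

instance [Finite A] [Finite C] : Finite (Step A C) := by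
  refine Finite.of_injective (β := Option (Option (A ⊕ A ⊕ (A × A) ⊕ C))) (fun
    | .bot => none
    | .nil => some none
    | .left a => some (some (.inl a))
    | .right a => some (some (.inr (.inl a)))
    | .pair a b => some (some (.inr (.inr (.inl (a, b)))))
    | .fn f => some (some (.inr (.inr (.inr f))))) ?_
  intro x y h
  cases x <;> cases y <;> simp_all

/-- The action of the domain equation on a pair of monotone maps in opposite directions. -/
def map {A B : Type} [PartialOrder A] [PartialOrder B] (g : A →o B) (h : B →o A) :
    Step A (A →o A) →o Step B (B →o B) where
  toFun
    | .bot => .bot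
    | .nil => .nil
    | .left a => .left (g a)
    | .right a => .right (g a)
    | .pair a b => .pair (g a) (g b)
    | .fn f => .fn (g.comp (f.comp h))
  monotone' x y hxy := by
    cases hxy <;> constructor
    all_goals first | (apply g.monotone; assumption) | skip
    intro b
    apply g.monotone
    apply_assumption

end Step

/-- A finite poset with a least element and binary infima (equivalently, a finite Scott domain). -/
structure FinDom where
  carrier : Type
  [semi : SemilatticeInf carrier]
  [orderBot : OrderBot carrier]
  [fin : Finite carrier]

attribute [instance] FinDom.semi FinDom.orderBot FinDom.fin

/-- The finite approximations `D₀ = {⊥}`,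
`Dₙ₊₁ = (Nil + Left(Dₙ) + Right(Dₙ) + Pair(Dₙ × Dₙ) + Fun(Dₙ → Dₙ))_⊥`; on finite posets the
continuous functions are the monotone ones. -/
def approx : ℕ → FinDom
  | 0 => ⟨Unit⟩
  | n + 1 => 
    have : Finite ((approx n).carrier →o (approx n).carrier) := DFunLike.finite _
    ⟨Step (approx n).carrier ((approx n).carrier →o (approx n).carrier)⟩

/-- The `n`-th approximation `Dₙ` as a type. -/
abbrev Approx (n : ℕ) : Type := (approx n).carrier

/-- The embedding/projection maps `Dₙ → Dₘ` and `Dₘ → Dₙ`, obtained by iterating the action of the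
domain equation: the first is the canonical embedding and the second the canonical projection if
`n ≤ m`, and the other way round if `m ≤ n`. -/
def maps : (n m : ℕ) → (Approx n →o Approx m) × (Approx m →o Approx n)
  | 0, _ => (OrderHom.const _ ⊥, OrderHom.const _ ⊥)
  | _ + 1, 0 => (OrderHom.const _ ⊥, OrderHom.const _ ⊥)
  | n + 1, m + 1 => (Step.map (maps n m).1 (maps n m).2, Step.map (maps n m).2 (maps n m).1)

/-- The canonical map `Dₙ → Dₘ`: an embedding if `n ≤ m`, a projection if `m ≤ n`. -/
def shift (n m : ℕ) : Approx n →o Approx m := (maps n m).1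

theorem maps_swap : ∀ n m, maps m n = (maps n m).swap
  | 0, 0 => rfl
  | 0, _ + 1 => rfl
  | _ + 1, 0 => rfl
  | n + 1, m + 1 => by
    change (Step.map (maps m n).1 (maps m n).2, Step.map (maps m n).2 (maps m n).1) =
      (Step.map (maps n m).2 (maps n m).1, Step.map (maps n m).1 (maps n m).2)
    rw [maps_swap n m]; rfl

theorem maps_snd (n m : ℕ) : (maps n m).2 = shift m n := by
  rw [shift, maps_swap n m]; rfl

theorem shift_succ (n m : ℕ) :
    shift (n + 1) (m + 1) = Step.map (shift n m) (shift m n) := by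
  rw [← maps_snd n m]; rfl

theorem shift_zero_left (m : ℕ) (a : Approx 0) : shift 0 m a = ⊥ := rfl

theorem approx_zero_eq (a b : Approx 0) : a = b := rfl

theorem shift_bot : ∀ n m, shift n m ⊥ = ⊥
  | 0, _ => rfl
  | _ + 1, 0 => rfl
  | n + 1, m + 1 => by rw [shift_succ]; rfl

theorem Step.map_comp {A B C : Type} [PartialOrder A] [PartialOrder B] [PartialOrder C]
    (g : A →o B) (h : B →o A) (g' : B →o C) (h' : C →o B) (x : Step A (A →o A)) :
    Step.map g' h' (Step.map g h x) = Step.map (g'.comp g) (h.comp h') x := by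
  cases x <;> rfl

theorem Step.map_id {A : Type} [PartialOrder A] (x : Step A (A →o A)) :
    Step.map OrderHom.id OrderHom.id x = x := by
  cases x <;> rfl

theorem Step.map_mono {A B : Type} [PartialOrder A] [PartialOrder B] {g g' : A →o B}
    {h h' : B →o A} (hg : g ≤ g') (hh : h ≤ h') (x : Step A (A →o A)) :
    Step.map g h x ≤ Step.map g' h' x := by
  cases x with
  | bot => exact .bot _
  | nil => exact .nil
  | left a => exact .left (hg a)
  | right a => exact .right (hg a)
  | pair a b => exact .pair (hg a) (hg b)
  | fn f => exact .fn fun b => (hg _).trans (g'.monotone (f.monotone (hh b)))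

theorem shift_self : ∀ n, shift n n = OrderHom.id
  | 0 => rfl
  | n + 1 => by
    rw [shift_succ, shift_self n]; ext1; funext x; exact Step.map_id x

theorem shift_shift : ∀ {n m k : ℕ}, (k ≤ m ∨ n ≤ m) → ∀ a, shift m k (shift n m a) = shift n k a
  | 0, m, k, _, a => by rw [shift_zero_left, shift_zero_left, shift_bot]
  | n + 1, m, 0, _, a => rfl
  | n + 1, 0, k + 1, h, a => by omega
  | n + 1, m + 1, k + 1, h, a => by
    rw [shift_succ, shift_succ, shift_succ]
    refine (Step.map_comp _ _ _ _ a).trans ?_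
    have h1 : (shift m k).comp (shift n m) = shift n k := by
      ext1; funext a; exact shift_shift (by omega) a
    have h2 : (shift m n).comp (shift k m) = shift k n := by
      ext1; funext a; exact shift_shift (by omega) a
    rw [h1, h2]; rfl

theorem shift_shift_le : ∀ (n m k : ℕ) (a), shift m k (shift n m a) ≤ shift n k a
  | 0, m, k, a => by rw [shift_zero_left, shift_zero_left, shift_bot]
  | n + 1, m, 0, a => le_rfl
  | n + 1, 0, k + 1, a => (bot_le : (⊥ : Approx (k + 1)) ≤ _)
  | n + 1, m + 1, k + 1, a => by
    rw [shift_succ, shift_succ, shift_succ]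
    refine (Step.map_comp _ _ _ _ a).le.trans ?_
    exact Step.map_mono (fun a => shift_shift_le n m k a) (fun a => shift_shift_le k m n a) a

/-- The domain of realizers: the canonical (minimal) solution of the domain equation
`D = (Nil + Left(D) + Right(D) + Pair(D × D) + Fun(D → D))_⊥`, constructed as the projective limit
of its finite approximations, ordered componentwise. See `D.domainEquation` for the isomorphism and
`D.isLUB_emb_proj` for minimality (the projections to the finite stages have supremum `id`). -/
def D : Type := {x : ∀ n, Approx n // ∀ n m, m ≤ n → shift n m (x n) = x m}

namespace D

instance : PartialOrder D := inferInstanceAs (PartialOrder (Subtype _))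

/-- The projection of `D` to its `n`-th approximation. -/
def proj (n : ℕ) (x : D) : Approx n := x.1 n

theorem ext {x y : D} (h : ∀ n, x.proj n = y.proj n) : x = y := Subtype.ext (funext h)

theorem le_def {x y : D} : x ≤ y ↔ ∀ n, x.proj n ≤ y.proj n := Iff.rfl

theorem shift_proj (x : D) {n m : ℕ} (h : m ≤ n) : shift n m (x.proj n) = x.proj m := x.2 n m h

theorem shift_proj_le (x : D) (n m : ℕ) : shift n m (x.proj n) ≤ x.proj m := by
  rcases le_total m n with h | h
  · exact (x.shift_proj h).le
  · rw [← x.shift_proj h]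
    exact (shift_shift_le m n m _).trans (by rw [shift_self]; exact le_rfl)

/-- The embedding of the `n`-th approximation into `D`. -/
def emb (n : ℕ) (a : Approx n) : D :=
  ⟨fun m => shift n m a, fun _ _ h => shift_shift (Or.inl h) a⟩

theorem emb_mono (n : ℕ) : Monotone (emb n) := fun _ _ h m => (shift n m).monotone h

theorem emb_shift {n m : ℕ} (h : n ≤ m) (a : Approx n) : emb m (shift n m a) = emb n a :=
  ext fun _ => shift_shift (Or.inr h) a

theorem emb_proj_le (n : ℕ) (x : D) : emb n (x.proj n) ≤ x := fun m => x.shift_proj_le n m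

theorem proj_emb (n : ℕ) (a : Approx n) : (emb n a).proj n = a := by
  change shift n n a = a
  rw [shift_self]; rfl

theorem proj_mono (n : ℕ) : Monotone (proj n) := fun _ _ h => h n

instance : OrderBot D where
  bot := ⟨fun _ => ⊥, fun n m _ => shift_bot n m⟩
  bot_le _ _ := bot_le

/-- The element of `D` whose projection to `Dₙ₊₁` is `s n`. -/
def ofStep (s : ∀ n, Step (Approx n) (Approx n →o Approx n))
    (hs : ∀ n m, m ≤ n → Step.map (shift n m) (shift m n) (s n) = s m) : D where
  val
    | 0 => ⊥
    | n + 1 => s n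
  property
    | _, 0, _ => rfl
    | n + 1, m + 1, h => by
      rw [shift_succ]; exact hs n m (Nat.le_of_succ_le_succ h)

/-- The element `Nil`. -/
def nil : D := ofStep (fun _ => .nil) fun _ _ _ => rfl

/-- The constructor `Left`. -/
def left (a : D) : D :=
  ofStep (fun n => .left (a.proj n)) fun _ _ h => congrArg Step.left (a.shift_proj h)

/-- The constructor `Right`. -/
def right (a : D) : D :=
  ofStep (fun n => .right (a.proj n)) fun _ _ h => congrArg Step.right (a.shift_proj h)

/-- The constructor `Pair`. -/
def pair (a b : D) : D :=
  ofStep (fun n => .pair (a.proj n) (b.proj n)) fun _ _ h =>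
    congrArg₂ Step.pair (a.shift_proj h) (b.shift_proj h)

/-- The domain `D → D` of Scott continuous functions, ordered pointwise. -/
abbrev Cont : Type := {f : D → D // ScottContinuous f}

/-- The restriction `Dₙ → Dₙ` of a continuous function. -/
def restrict (f : Cont) (n : ℕ) : Approx n →o Approx n where
  toFun a := (f.1 (emb n a)).proj n
  monotone' _ _ h := f.2.monotone (emb_mono n h) n

/-- The injection `Fun` of `D → D` into `D`. -/
def fn (f : Cont) : D :=
  ofStep (fun n => .fn (restrict f n)) fun n m h => by
    refine congrArg Step.fn ?_
    ext1; funext a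
    change shift n m ((f.1 (emb n (shift m n a))).proj n) = (f.1 (emb m a)).proj m
    rw [emb_shift h, shift_proj _ h]


/-! Towards the domain equation. -/

theorem isLUB_emb_proj (x : D) : IsLUB (Set.range fun n => emb n (x.proj n)) x := by
  refine ⟨?_, fun b hb n => ?_⟩
  · rintro _ ⟨n, rfl⟩; exact emb_proj_le n x
  · have := hb ⟨n, rfl⟩ n
    change (emb n (x.proj n)).proj n ≤ _ at this
    rwa [proj_emb] at this

theorem emb_proj_chain (x : D) : Monotone fun n => emb n (x.proj n) := fun n m h => by
  change emb n (x.proj n) ≤ emb m (x.proj m)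
  rw [← emb_shift h]
  exact emb_mono m (x.shift_proj_le n m)

/-- The supremum of a directed set is attained in every component. -/
theorem exists_proj_eq {S : Set D} (h0 : S.Nonempty) (hd : DirectedOn (· ≤ ·) S) {s : D}
    (hs : IsLUB S s) (n : ℕ) : ∃ x ∈ S, x.proj n = s.proj n := by
  have key : ∀ n, ∃ x ∈ S, ∀ y ∈ S, y.proj n ≤ x.proj n := by
    intro n
    obtain ⟨a, ⟨x, hx, rfl⟩, hmax⟩ :=
      (Set.toFinite (proj n '' S)).exists_maximal (h0.image _)
    refine ⟨x, hx, fun y hy => ?_⟩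
    obtain ⟨z, hz, hxz, hyz⟩ := hd x hx y hy
    exact (hyz n).trans (hmax ⟨z, hz, rfl⟩ (hxz n))
  choose x hx hmax using key
  let u : D := ⟨fun n => (x n).proj n, fun n m h => by
    rw [shift_proj _ h]
    refine le_antisymm (hmax m _ (hx n)) ?_
    obtain ⟨z, hz, h1, h2⟩ := hd _ (hx n) _ (hx m)
    refine (h2 m).trans ?_
    change z.proj m ≤ _
    rw [← z.shift_proj h, ← (x n).shift_proj h]
    exact (shift n m).monotone (hmax n z hz)⟩
  have hu : u ∈ upperBounds S := fun y hy n => hmax n y hy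
  exact ⟨x n, hx n, le_antisymm (hs.1 (hx n) n) (hs.2 hu n)⟩

/-- Suprema of increasing sequences of embedded elements. -/
theorem exists_sup (z : ∀ n, Approx n) (hz : Monotone fun n => emb n (z n)) :
    ∃ u : D, ∀ m, (∀ n, shift n m (z n) ≤ u.proj m) ∧ ∃ N, ∀ n, N ≤ n →
      u.proj m = shift n m (z n) := by
  have key : ∀ m, ∃ N, ∀ n, N ≤ n → shift N m (z N) = shift n m (z n) := fun m =>
    WellFoundedGT.monotone_chain_condition (⟨fun n => shift n m (z n), fun _ _ h => hz h m⟩)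
  choose N hN using key
  refine ⟨⟨fun m => shift (N m) m (z (N m)), fun n m h => ?_⟩, fun m => ⟨fun n => ?_, N m, hN m⟩⟩
  · change shift n m (shift (N n) n (z (N n))) = shift (N m) m (z (N m))
    rw [hN n _ (le_max_left (N n) (N m)), hN m _ (le_max_right (N n) (N m)),
      shift_shift (Or.inl h)]
  · change _ ≤ shift (N m) m (z (N m))
    rw [hN m _ (le_max_left (N m) n)]
    exact hz (le_max_right (N m) n) m

theorem restrict_mono {f g : Cont} (h : f ≤ g) (n : ℕ) : restrict f n ≤ restrict g n :=
  fun a => h (emb n a) n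

theorem le_of_restrict_le {f g : Cont} (h : ∀ n, restrict f n ≤ restrict g n) : f ≤ g := by
  intro y
  have hd : DirectedOn (· ≤ ·) (Set.range fun n => emb n (y.proj n)) :=
    (emb_proj_chain y).directed_le.directedOn_range
  refine (f.2 (Set.range_nonempty _) hd (isLUB_emb_proj y)).2 ?_
  rintro _ ⟨_, ⟨n, rfl⟩, rfl⟩
  intro m
  change (f.1 (emb n (y.proj n))).proj m ≤ (g.1 y).proj m
  rw [← shift_proj _ (le_max_right n m), ← (g.1 y).shift_proj (le_max_right n m)]
  refine (shift _ m).monotone ?_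
  refine (f.2.monotone (emb_proj_chain y (le_max_left n m)) _).trans ?_
  exact (h _ _).trans (g.2.monotone (emb_proj_le _ y) _)

/-- Every coherent sequence of monotone functions `Dₙ → Dₙ` comes from a continuous function. -/
theorem exists_restrict_eq (g : ∀ n, Approx n →o Approx n)
    (hg : ∀ n m, m ≤ n → (shift n m).comp ((g n).comp (shift m n)) = g m) :
    ∃ f : Cont, ∀ n, restrict f n = g n := by
  have hg' : ∀ {n m}, m ≤ n → ∀ a, shift n m (g n (shift m n a)) = g m a := fun h a =>
    DFunLike.congr_fun (hg _ _ h) a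
  have hchain : ∀ y : D, Monotone fun n => emb n (g n (y.proj n)) := by
    intro y n m h k
    change shift n k _ ≤ shift m k _
    rw [← hg' h]
    exact (shift_shift_le _ _ _ _).trans
      ((shift m k).monotone ((g m).monotone (y.shift_proj_le n m)))
  choose f hf using fun y : D => exists_sup (fun n => g n (y.proj n)) (hchain y)
  have hmono : Monotone f := by
    intro y y' h m
    obtain ⟨N, hN⟩ := (hf y m).2
    change (f y).proj m ≤ (f y').proj m
    rw [hN N le_rfl]
    exact ((shift N m).monotone ((g N).monotone (h N))).trans ((hf y' m).1 N)
  refine ⟨⟨f, fun S h0 hd s hs => ⟨?_, fun b hb m => ?_⟩⟩, fun n => ?_⟩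
  · rintro _ ⟨x, hx, rfl⟩; exact hmono (hs.1 hx)
  · obtain ⟨N, hN⟩ := (hf s m).2
    change (f s).proj m ≤ b.proj m
    obtain ⟨x, hx, hxs⟩ := exists_proj_eq h0 hd hs N
    rw [hN N le_rfl, ← hxs]
    exact ((hf x m).1 N).trans (hb ⟨x, hx, rfl⟩ m)
  · ext1; funext a
    change (f (emb n a)).proj n = g n a
    obtain ⟨N, hN⟩ := (hf (emb n a) n).2
    rw [hN _ (le_max_left N n)]
    exact hg' (le_max_right N n) a

/-- The injection of all summands into `D`. -/
def roll : Step D Cont → D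
  | .bot => ⊥
  | .nil => nil
  | .left a => left a
  | .right a => right a
  | .pair a b => pair a b
  | .fn f => fn f

theorem roll_mono : Monotone roll := by
  intro s t h n
  match n with
  | 0 => exact le_rfl
  | n + 1 =>
    cases h with
    | bot => exact (bot_le : (⊥ : D) ≤ roll t) (n + 1)
    | nil => exact Step.Le.nil
    | left h => exact Step.Le.left (h n)
    | right h => exact Step.Le.right (h n)
    | pair h k => exact Step.Le.pair (h n) (k n)
    | fn h => exact Step.Le.fn (restrict_mono h n)

/-- The `n+1`-st projection of an element of `D`, as an element of the lifted sum. -/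
def projStep (n : ℕ) (x : D) : Step (Approx n) (Approx n →o Approx n) := x.proj (n + 1)

theorem map_projStep (x : D) {n m : ℕ} (h : m ≤ n) :
    Step.map (shift n m) (shift m n) (x.projStep n) = x.projStep m := by
  have := x.shift_proj (Nat.succ_le_succ h)
  rwa [shift_succ] at this

theorem ext_step {x y : D} (h : ∀ n, x.projStep n = y.projStep n) : x = y :=
  ext fun n => match n with
    | 0 => rfl
    | n + 1 => h n

theorem le_of_roll_le {s t : Step D Cont} (h : roll s ≤ roll t) : s ≤ t := by
  have h' : ∀ n, Step.Le ((roll s).projStep n) ((roll t).projStep n) := fun n => h (n + 1)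
  cases s with
  | bot => exact .bot _
  | nil => cases t with
    | nil => exact .nil
    | _ => nomatch h' 0
  | left a => cases t with
    | left b => exact .left fun n => by cases h' n; assumption
    | _ => nomatch h' 0
  | right a => cases t with
    | right b => exact .right fun n => by cases h' n; assumption
    | _ => nomatch h' 0
  | pair a a' => cases t with
    | pair b b' =>
      exact .pair (fun n => by cases h' n; assumption) (fun n => by cases h' n; assumption)
    | _ => nomatch h' 0
  | fn f => cases t with
    | fn g => exact .fn (le_of_restrict_le fun n => by cases h' n; assumption)
    | _ => nomatch h' 0

theorem roll_surjective : Function.Surjective roll := by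
  intro x
  have hx := fun n => x.map_projStep (Nat.zero_le n)
  have hc := fun n m (h : m ≤ n) => x.map_projStep h
  cases h0 : x.projStep 0 with
  | bot =>
    refine ⟨.bot, ext_step fun n => ?_⟩
    have := hx n
    rw [h0] at this
    cases hn : x.projStep n <;> rw [hn] at this <;> first | rfl | cases this
  | nil =>
    refine ⟨.nil, ext_step fun n => ?_⟩
    have := hx n
    rw [h0] at this
    cases hn : x.projStep n <;> rw [hn] at this <;> first | rfl | cases this
  | left a =>
    have key : ∀ n, ∃ a, x.projStep n = .left a := by
      intro n
      have := hx n
      rw [h0] at this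
      cases hn : x.projStep n <;> rw [hn] at this <;> first | exact ⟨_, rfl⟩ | cases this
    choose u hu using key
    refine ⟨.left ⟨u, fun n m h => ?_⟩, ext_step fun n => (hu n).symm⟩
    have := hc n m h
    rw [hu, hu] at this
    exact Step.left.inj this
  | right a =>
    have key : ∀ n, ∃ a, x.projStep n = .right a := by
      intro n
      have := hx n
      rw [h0] at this
      cases hn : x.projStep n <;> rw [hn] at this <;> first | exact ⟨_, rfl⟩ | cases this
    choose u hu using key
    refine ⟨.right ⟨u, fun n m h => ?_⟩, ext_step fun n => (hu n).symm⟩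
    have := hc n m h
    rw [hu, hu] at this
    exact Step.right.inj this
  | pair a b =>
    have key : ∀ n, ∃ a b, x.projStep n = .pair a b := by
      intro n
      have := hx n
      rw [h0] at this
      cases hn : x.projStep n <;> rw [hn] at this <;> first | exact ⟨_, _, rfl⟩ | cases this
    choose u v hu using key
    refine ⟨.pair ⟨u, fun n m h => ?_⟩ ⟨v, fun n m h => ?_⟩, ext_step fun n => (hu n).symm⟩
    · have := hc n m h
      rw [hu, hu] at this
      exact (Step.pair.inj this).1
    · have := hc n m h
      rw [hu, hu] at this
      exact (Step.pair.inj this).2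
  | fn g =>
    have key : ∀ n, ∃ g, x.projStep n = .fn g := by
      intro n
      have := hx n
      rw [h0] at this
      cases hn : x.projStep n <;> rw [hn] at this <;> first | exact ⟨_, rfl⟩ | cases this
    choose u hu using key
    obtain ⟨f, hf⟩ := exists_restrict_eq u fun n m h => by
      have := hc n m h
      rw [hu, hu] at this
      exact Step.fn.inj this
    refine ⟨.fn f, ext_step fun n => ?_⟩
    rw [hu, ← hf]; rfl

/-- `D` satisfies the recursive domain equation
`D = (Nil + Left(D) + Right(D) + Pair(D × D) + Fun(D → D))_⊥`. -/
noncomputable def domainEquation : Step D Cont ≃o D :=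
  RelIso.ofSurjective (r := (· ≤ ·)) (s := (· ≤ ·))
    ⟨⟨roll, fun _ _ h => le_antisymm (le_of_roll_le h.le) (le_of_roll_le h.ge)⟩,
      ⟨le_of_roll_le, fun h => roll_mono h⟩⟩ roll_surjective

/-! `D` is bounded complete. -/

theorem exists_isGLB_approx {n : ℕ} {S : Set (Approx n)} (h0 : S.Nonempty) :
    ∃ u, IsGLB S u := by
  have hf := Set.toFinite S
  have h0' : hf.toFinset.Nonempty := by simpa using h0
  refine ⟨hf.toFinset.inf' h0' id, fun a ha => ?_, fun b hb => ?_⟩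
  · exact Finset.inf'_le id (by simpa using ha)
  · exact Finset.le_inf' _ _ fun a ha => hb (by simpa using ha)

theorem gc_shift {n m : ℕ} (h : m ≤ n) : GaloisConnection (shift m n) (shift n m) := by
  intro a b
  constructor
  · intro hab
    have := (shift n m).monotone hab
    rwa [shift_shift (Or.inl h), shift_self] at this
  · intro hab
    refine ((shift m n).monotone hab).trans ((shift_shift_le n m n b).trans ?_)
    rw [shift_self]; exact le_rfl

theorem exists_isGLB {S : Set D} (h0 : S.Nonempty) : ∃ u, IsGLB S u := by
  choose u hu using fun n => exists_isGLB_approx (h0.image (proj n))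
  refine ⟨⟨u, fun n m h => ?_⟩, fun x hx n => (hu n).1 ⟨x, hx, rfl⟩, fun b hb n => (hu n).2 ?_⟩
  · have h1 := (gc_shift h).isGLB_u_image (hu n)
    rw [Set.image_image, Set.image_congr fun x _ => x.shift_proj h] at h1
    exact h1.unique (hu m)
  · rintro _ ⟨x, hx, rfl⟩
    exact hb hx n

theorem exists_isLUB {S : Set D} (hS : BddAbove S) : ∃ u, IsLUB S u := by
  obtain ⟨u, hu⟩ := exists_isGLB hS
  exact ⟨u, isGLB_upperBounds.1 hu⟩

theorem isLUB_apply {S : Set Cont} {h : Cont} (hS : IsLUB S h) (a : D) :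
    IsLUB ((fun f : Cont => f.1 a) '' S) (h.1 a) := by
  have hb : ∀ a, BddAbove ((fun f : Cont => f.1 a) '' S) := fun a =>
    ⟨h.1 a, by rintro _ ⟨f, hf, rfl⟩; exact hS.1 hf a⟩
  choose g hg using fun a => exists_isLUB (hb a)
  have hc : ScottContinuous g := by
    have hm : Monotone g := by
      intro x y hxy
      refine (hg x).2 ?_
      rintro _ ⟨f, hf, rfl⟩
      exact (f.2.monotone hxy).trans ((hg y).1 ⟨f, hf, rfl⟩)
    intro d h0 hd s hs
    refine ⟨?_, fun b hb => (hg s).2 ?_⟩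
    · rintro _ ⟨x, hx, rfl⟩; exact hm (hs.1 hx)
    · rintro _ ⟨f, hf, rfl⟩
      refine (f.2 h0 hd hs).2 ?_
      rintro _ ⟨x, hx, rfl⟩
      exact ((hg x).1 ⟨f, hf, rfl⟩).trans (hb ⟨x, hx, rfl⟩)
  have h1 : h ≤ ⟨g, hc⟩ := hS.2 fun f hf a => (hg a).1 ⟨f, hf, rfl⟩
  have h2 : g a ≤ h.1 a := (hg a).2 (by rintro _ ⟨f, hf, rfl⟩; exact hS.1 hf a)
  rw [le_antisymm (h1 a) h2]
  exact hg a

end D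

open D

/-- A subdomain of `D`: a subset that is downwards closed and closed under suprema of bounded
subsets. (In particular it contains `⊥`, the supremum of the empty set.) -/
@[ext]
structure Subdomain where
  carrier : Set D
  lower' : ∀ x ∈ carrier, ∀ y ≤ x, y ∈ carrier
  sup' : ∀ S ⊆ carrier, BddAbove S → ∀ s, IsLUB S s → s ∈ carrier

namespace Subdomain

instance : SetLike Subdomain D where
  coe := carrier
  coe_injective _ _ := Subdomain.ext

theorem lower (X : Subdomain) {x y : D} (hx : x ∈ X) (h : y ≤ x) : y ∈ X := X.lower' x hx y h

theorem sup_mem (X : Subdomain) {S : Set D} (hS : ∀ x ∈ S, x ∈ X) {s : D} (hs : IsLUB S s) :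
    s ∈ X := X.sup' S hS ⟨s, hs.1⟩ s hs

theorem bot_mem (X : Subdomain) : ⊥ ∈ X :=
  X.sup_mem (S := ∅) (fun _ h => h.elim) isLUB_empty

/-- The intersection of a family of subdomains. -/
def inter (F : Set Subdomain) : Subdomain where
  carrier := ⋂ X ∈ F, (X : Set D)
  lower' x hx y h := by
    simp only [Set.mem_iInter, SetLike.mem_coe] at hx ⊢
    exact fun X hX => X.lower (hx X hX) h
  sup' S hS hb s hs := by
    simp only [Set.mem_iInter, SetLike.mem_coe]
    refine fun X hX => X.sup_mem (fun x hx => ?_) hs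
    have := hS hx
    simp only [Set.mem_iInter, SetLike.mem_coe] at this
    exact this X hX

/-- A criterion for subdomains in terms of the domain equation. -/
theorem lower_and_sup {c : Set D} (p : Step D Cont → Prop) (hc : ∀ t, roll t ∈ c ↔ p t)
    (hl : ∀ s t, Step.Le s t → p t → p s)
    (hs : ∀ T : Set (Step D Cont), (∀ t ∈ T, p t) → ∀ t, IsLUB T t → p t) :
    (∀ x ∈ c, ∀ y ≤ x, y ∈ c) ∧ ∀ S ⊆ c, BddAbove S → ∀ s, IsLUB S s → s ∈ c := by
  constructor
  · intro x hx y h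
    obtain ⟨s, rfl⟩ := roll_surjective x
    obtain ⟨t, rfl⟩ := roll_surjective y
    exact (hc t).2 (hl t s (le_of_roll_le h) ((hc s).1 hx))
  · intro S hS _ s hs'
    obtain ⟨t, rfl⟩ := roll_surjective s
    refine (hc t).2 (hs (roll ⁻¹' S) (fun t ht => (hc t).1 (hS ht)) t ?_)
    refine ⟨fun u hu => le_of_roll_le (hs'.1 hu), fun u hu => le_of_roll_le (hs'.2 fun x hx => ?_)⟩
    obtain ⟨v, rfl⟩ := roll_surjective x
    exact roll_mono (hu hx)

theorem roll_injective : Function.Injective roll := domainEquation.injective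

/-- The subdomain `{Nil, ⊥}`. -/
def one : Subdomain :=
  have h := lower_and_sup (c := {nil, ⊥}) (fun t => match t with | .bot | .nil => True | _ => False)
    (fun t => by
      constructor
      · rintro (h | h)
        · cases roll_injective (a₂ := .nil) h; trivial
        · cases roll_injective (a₂ := .bot) h; trivial
      · cases t <;> intro h
        · exact Or.inr rfl
        · exact Or.inl rfl
        all_goals exact h.elim)
    (fun s t h ht => by cases h <;> trivial)
    (fun T hT t ht => by
      have h : t ≤ .nil := ht.2 fun u hu => by
        have := hT u hu
        cases u <;> first | exact this.elim | constructor
      cases h <;> trivial)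
  ⟨{nil, ⊥}, h.1, h.2⟩

/-- The subdomain `(X + Y)_⊥`. -/
def sum (X Y : Subdomain) : Subdomain :=
  have h := lower_and_sup (c := left '' X ∪ right '' Y ∪ {⊥})
    (fun t => match t with | .bot => True | .left a => a ∈ X | .right b => b ∈ Y | _ => False)
    (fun t => by
      constructor
      · rintro ((⟨a, ha, h⟩ | ⟨a, ha, h⟩) | h)
        · cases roll_injective (a₁ := .left a) h; exact ha
        · cases roll_injective (a₁ := .right a) h; exact ha
        · cases roll_injective (a₂ := .bot) h; trivial
      · cases t <;> intro h
        · exact Or.inr rfl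
        · exact h.elim
        · exact Or.inl (Or.inl ⟨_, h, rfl⟩)
        · exact Or.inl (Or.inr ⟨_, h, rfl⟩)
        all_goals exact h.elim)
    (fun s t h ht => by
      cases h
      · trivial
      · exact ht
      · exact X.lower ht ‹_›
      · exact Y.lower ht ‹_›
      · exact ht
      · exact ht)
    (fun T hT t ht => by
      have hbot : (∀ u ∈ T, u = .bot) → t = .bot := fun h =>
        le_antisymm (ht.2 fun u hu => (h u hu).le) (Step.Le.bot t)
      cases t with
      | bot => trivial
      | left a =>
        refine X.sup_mem (S := {b | .left b ∈ T}) (fun b hb => hT _ hb) ⟨fun b hb => ?_, fun c hc => ?_⟩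
        · cases ht.1 hb; assumption
        · have : (.left a : Step D Cont) ≤ .left c := ht.2 fun u hu => by
            cases ht.1 hu with
            | bot => exact .bot _
            | left h => exact .left (hc hu)
          cases this; assumption
      | right a =>
        refine Y.sup_mem (S := {b | .right b ∈ T}) (fun b hb => hT _ hb) ⟨fun b hb => ?_, fun c hc => ?_⟩
        · cases ht.1 hb; assumption
        · have : (.right a : Step D Cont) ≤ .right c := ht.2 fun u hu => by
            cases ht.1 hu with
            | bot => exact .bot _
            | right h => exact .right (hc hu)
          cases this; assumption
      | _ =>
        refine nomatch hbot fun u hu => ?_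
        have := hT u hu
        cases ht.1 hu <;> first | rfl | exact this.elim)
  ⟨left '' X ∪ right '' Y ∪ {⊥}, h.1, h.2⟩

/-- The subdomain `(X × Y)_⊥`. -/
def prod (X Y : Subdomain) : Subdomain :=
  have h := lower_and_sup (c := {x | ∃ a ∈ X, ∃ b ∈ Y, x = pair a b} ∪ {⊥})
    (fun t => match t with | .bot => True | .pair a b => a ∈ X ∧ b ∈ Y | _ => False)
    (fun t => by
      constructor
      · rintro (⟨a, ha, b, hb, h⟩ | h)
        · cases roll_injective (a₂ := .pair a b) h; exact ⟨ha, hb⟩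
        · cases roll_injective (a₂ := .bot) h; trivial
      · cases t <;> intro h
        · exact Or.inr rfl
        · exact h.elim
        · exact h.elim
        · exact h.elim
        · exact Or.inl ⟨_, h.1, _, h.2, rfl⟩
        · exact h.elim)
    (fun s t h ht => by
      cases h
      · trivial
      · exact ht
      · exact ht
      · exact ht
      · exact ⟨X.lower ht.1 ‹_›, Y.lower ht.2 ‹_›⟩
      · exact ht)
    (fun T hT t ht => by
      have hbot : (∀ u ∈ T, u = .bot) → t = .bot := fun h =>
        le_antisymm (ht.2 fun u hu => (h u hu).le) (Step.Le.bot t)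
      cases t with
      | bot => trivial
      | pair a b =>
        constructor
        · refine X.sup_mem (S := {c | ∃ d, .pair c d ∈ T}) (fun c ⟨d, hd⟩ => (hT (.pair c d) hd).1)
            ⟨fun c ⟨d, hd⟩ => ?_, fun c hc => ?_⟩
          · cases ht.1 hd; assumption
          · have : (.pair a b : Step D Cont) ≤ .pair c b := ht.2 fun u hu => by
              cases ht.1 hu with
              | bot => exact .bot _
              | pair h k => exact .pair (hc ⟨_, hu⟩) k
            cases this; assumption
        · refine Y.sup_mem (S := {d | ∃ c, .pair c d ∈ T}) (fun d ⟨c, hd⟩ => (hT (.pair c d) hd).2)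
            ⟨fun d ⟨c, hd⟩ => ?_, fun d hd => ?_⟩
          · cases ht.1 hd; assumption
          · have : (.pair a b : Step D Cont) ≤ .pair a d := ht.2 fun u hu => by
              cases ht.1 hu with
              | bot => exact .bot _
              | pair h k => exact .pair h (hd ⟨_, hu⟩)
            cases this; assumption
      | _ =>
        refine nomatch hbot fun u hu => ?_
        have := hT u hu
        cases ht.1 hu <;> first | rfl | exact this.elim)
  ⟨{x | ∃ a ∈ X, ∃ b ∈ Y, x = pair a b} ∪ {⊥}, h.1, h.2⟩

/-- The subdomain `(X → Y)_⊥` of all `Fun(f)` such that `f` maps `X` to `Y`, and `⊥`. -/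
def arrow (X Y : Subdomain) : Subdomain :=
  have h := lower_and_sup (c := {x | ∃ f : Cont, (∀ a ∈ X, f.1 a ∈ Y) ∧ x = fn f} ∪ {⊥})
    (fun t => match t with | .bot => True | .fn f => ∀ a ∈ X, f.1 a ∈ Y | _ => False)
    (fun t => by
      constructor
      · rintro (⟨f, hf, h⟩ | h)
        · cases roll_injective (a₂ := .fn f) h; exact hf
        · cases roll_injective (a₂ := .bot) h; trivial
      · cases t <;> intro h
        · exact Or.inr rfl
        · exact h.elim
        · exact h.elim
        · exact h.elim
        · exact h.elim
        · exact Or.inl ⟨_, h, rfl⟩)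
    (fun s t h ht => by
      cases h
      · trivial
      · exact ht
      · exact ht
      · exact ht
      · exact ht
      · rename_i h
        exact fun a ha => Y.lower (ht a ha) (h a))
    (fun T hT t ht => by
      have hbot : (∀ u ∈ T, u = .bot) → t = .bot := fun h =>
        le_antisymm (ht.2 fun u hu => (h u hu).le) (Step.Le.bot t)
      cases t with
      | bot => trivial
      | fn f =>
        intro a ha
        have hf : IsLUB {g | .fn g ∈ T} f := by
          refine ⟨fun g hg => ?_, fun g hg => ?_⟩
          · cases ht.1 hg; assumption
          · have : (.fn f : Step D Cont) ≤ .fn g := ht.2 fun u hu => by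
              cases ht.1 hu with
              | bot => exact .bot _
              | fn h => exact .fn (hg hu)
            cases this; assumption
        refine Y.sup_mem ?_ (isLUB_apply hf a)
        rintro _ ⟨g, hg, rfl⟩
        exact hT _ hg a ha
      | _ =>
        refine nomatch hbot fun u hu => ?_
        have := hT u hu
        cases ht.1 hu <;> first | rfl | exact this.elim)
  ⟨{x | ∃ f : Cont, (∀ a ∈ X, f.1 a ∈ Y) ∧ x = fn f} ∪ {⊥}, h.1, h.2⟩

end Subdomain

/-- Type expressions, with type variables named by natural numbers. In `fix α ρ` the variable `α`
is bound in `ρ`. See `Ty.WellFormed` for the strict positivity condition. -/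
inductive Ty : Type
  | var (α : ℕ) : Ty
  | one : Ty
  | sum (ρ σ : Ty) : Ty
  | prod (ρ σ : Ty) : Ty
  | arrow (ρ σ : Ty) : Ty
  | fix (α : ℕ) (ρ : Ty) : Ty

namespace Ty

/-- `α` occurs free in a type. -/
def Free (α : ℕ) : Ty → Prop
  | var β => β = α
  | one => False
  | sum ρ σ => Free α ρ ∨ Free α σ
  | prod ρ σ => Free α ρ ∨ Free α σ
  | arrow ρ σ => Free α ρ ∨ Free α σ
  | fix β ρ => β ≠ α ∧ Free α ρ

/-- A type is strictly positive in `α`: no free occurrence of `α` is within the left-hand side of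
a function type. -/
def StrictlyPositive (α : ℕ) : Ty → Prop
  | var _ => True
  | one => True
  | sum ρ σ => StrictlyPositive α ρ ∧ StrictlyPositive α σ
  | prod ρ σ => StrictlyPositive α ρ ∧ StrictlyPositive α σ
  | arrow ρ σ => ¬ Free α ρ ∧ StrictlyPositive α σ
  | fix β ρ => β = α ∨ StrictlyPositive α ρ

/-- The types proper: in every subexpression `fix α ρ`, `ρ` is strictly positive in `α`. -/
def WellFormed : Ty → Prop
  | var _ => True
  | one => True
  | sum ρ σ => WellFormed ρ ∧ WellFormed σ
  | prod ρ σ => WellFormed ρ ∧ WellFormed σ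
  | arrow ρ σ => WellFormed ρ ∧ WellFormed σ
  | fix α ρ => StrictlyPositive α ρ ∧ WellFormed ρ

/-- A type of the form `fix β₁. … fix βₙ. α` with `n ≥ 0` and all `βᵢ` different from `α`. -/
def IsFixChain (α : ℕ) : Ty → Prop
  | var β => β = α
  | fix β ρ => β ≠ α ∧ IsFixChain α ρ
  | _ => False

/-- A type is regular if it has no subexpression of the form `fix α. fix β₁. … fix βₙ. α`
with all `βᵢ` different from `α`. -/
def Regular : Ty → Prop
  | var _ => True
  | one => True
  | sum ρ σ => Regular ρ ∧ Regular σ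
  | prod ρ σ => Regular ρ ∧ Regular σ
  | arrow ρ σ => Regular ρ ∧ Regular σ
  | fix α ρ => ¬ IsFixChain α ρ ∧ Regular ρ

/-- The value of a type in an environment assigning subdomains to the type variables. -/
def val : Ty → (ℕ → Subdomain) → Subdomain
  | var α, ζ => ζ α
  | one, _ => Subdomain.one
  | sum ρ σ, ζ => (val ρ ζ).sum (val σ ζ)
  | prod ρ σ, ζ => (val ρ ζ).prod (val σ ζ)
  | arrow ρ σ, ζ => (val ρ ζ).arrow (val σ ζ)
  | fix α ρ, ζ =>
    -- the intersection of all subdomains `X` with `⟦ρ⟧ζ[α ↦ X] ⊆ X`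
    Subdomain.inter {X | (val ρ (Function.update ζ α X) : Set D) ⊆ X}

end Ty

end Realizers

/-! Let `trunc n` be the projection of `D` to its `n`-th approximation followed by the embedding
back. Every `x` is the supremum of its truncations, and subdomains are closed under existing
suprema. So `X ⊆ Y` holds as soon as `LeAt n X Y`, that is, truncation at `n` sends `X` into `Y`,
for every `n`.

The operator `X ↦ ⟦ρ⟧ζ[α ↦ X]` respects these stages. Each constructor of the domain equation gains
a stage, because `trunc (n + 1)` acts on a constructed element by applying `trunc n` to its
components. Hence a variable underneath a sum, product or arrow needs to be compared only at stages
below `n`. A variable can demand stage `n` itself only when no constructor guards it, that is, when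
the type is `fix β₁. … fix βₙ. α`, which regularity excludes for the body. (For the body `α` itself
every subdomain is a fixed point.) This is `leAt_val`.

Given a post-fixed point `X` and a pre-fixed point `Y`, induction on `n` then yields `LeAt n X Y`:
pass from `X` to `⟦ρ⟧` at `X`, truncate into `⟦ρ⟧` at `Y`, and return to `Y`. Since the operator is
monotone, the intersection of all pre-fixed points is itself a fixed point, so every post-fixed
point lies below it.

The delicate case of `leAt_val` is a nested `fix`. There `{x | trunc n x ∈ Z}` is used as a
pre-fixed point, so it must be a subdomain. This requires truncation to preserve all existing
suprema, not only directed ones (`isLUB_trunc`). -/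

namespace Realizers

/-! ### Truncations of `D` and their compatibility with constructors and suprema -/

namespace D

/-- The idempotent deflation of `D` onto (the image of) its `n`-th approximation. -/
def trunc (n : ℕ) (x : D) : D := emb n (x.proj n)

theorem trunc_le (n : ℕ) (x : D) : trunc n x ≤ x := emb_proj_le n x

theorem trunc_mono (n : ℕ) : Monotone (trunc n) := fun _ _ h => emb_mono n (proj_mono n h)

theorem trunc_le_trunc {n m : ℕ} (h : n ≤ m) (x : D) : trunc n x ≤ trunc m x :=
  emb_proj_chain x h

theorem trunc_bot (n : ℕ) : trunc n ⊥ = ⊥ := le_bot_iff.1 (trunc_le n ⊥)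

/-- The approximations are finite, so a directed set attains the `n`-th component of its supremum.
-/
theorem scottContinuous_trunc (n : ℕ) : ScottContinuous (trunc n) := by
  intro S h0 hd s hs
  refine ⟨?_, fun b hb => ?_⟩
  · rintro _ ⟨x, hx, rfl⟩
    exact trunc_mono n (hs.1 hx)
  · obtain ⟨x, hx, h⟩ := exists_proj_eq h0 hd hs n
    rw [trunc, ← h]
    exact hb ⟨x, hx, rfl⟩

/-- The function `f` truncated on both sides. -/
def truncCont (n : ℕ) (f : Cont) : Cont :=
  ⟨fun a => trunc n (f.1 (trunc n a)),
    (scottContinuous_trunc n).comp (f.2.comp (scottContinuous_trunc n))⟩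

/-- The action of `trunc (n + 1)` on the summands. -/
def truncStep (n : ℕ) : Step D Cont → Step D Cont
  | .bot => .bot
  | .nil => .nil
  | .left a => .left (trunc n a)
  | .right a => .right (trunc n a)
  | .pair a b => .pair (trunc n a) (trunc n b)
  | .fn f => .fn (truncCont n f)

/-- The source of all guardedness: peeling off one constructor lowers the truncation stage by one.
-/
theorem trunc_succ_roll (n : ℕ) (t : Step D Cont) :
    trunc (n + 1) (roll t) = roll (truncStep n t) := by
  cases t with
  | bot => exact trunc_bot _
  | _ =>
    refine ext fun m => ?_
    cases m with
    | zero => rfl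
    | succ m =>
      change shift (n + 1) (m + 1) _ = _
      rw [shift_succ]
      rfl

theorem isLUB_preimage_roll {S : Set D} {t : Step D Cont} (h : IsLUB S (roll t)) :
    IsLUB (roll ⁻¹' S) t := by
  refine ⟨fun u hu => le_of_roll_le (h.1 hu), fun u hu => le_of_roll_le (h.2 fun x hx => ?_)⟩
  obtain ⟨v, rfl⟩ := roll_surjective x
  exact roll_mono (hu hx)

/-- Inductive step of `isLUB_trunc`. Projections are upper adjoints of the embeddings, so
preservation of suprema is not formal. It holds here because suprema in the lifted sum are computed
inside one summand, componentwise for pairs and pointwise for functions. -/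
theorem isLUB_truncStep {n : ℕ}
    (ih : ∀ {S : Set D} {s : D}, IsLUB S s → IsLUB (trunc n '' S) (trunc n s))
    {T : Set (Step D Cont)} {t b : Step D Cont} (ht : IsLUB T t)
    (hb : ∀ u ∈ T, truncStep n u ≤ b) : truncStep n t ≤ b := by
  have hbot : (∀ u ∈ T, u = .bot) → t = .bot := fun h =>
    le_antisymm (ht.2 fun u hu => (h u hu).le) (Step.Le.bot t)
  have ih' : ∀ {S : Set D} {s c : D}, IsLUB S s → (∀ x ∈ S, trunc n x ≤ c) → trunc n s ≤ c :=
    fun hs hc => (ih hs).2 (by rintro _ ⟨x, hx, rfl⟩; exact hc x hx)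
  -- A member of `T` other than `⊥` has the same constructor as `t`, and through `hb` it forces that
  -- constructor on `b` too. Only components then remain to be compared.
  have hne : t ≠ .bot → ∃ u ∈ T, u ≠ .bot := fun h => by
    by_contra! h'
    exact h (hbot h')
  cases t with
  | bot => exact .bot _
  | nil =>
    obtain ⟨u, hu, h0⟩ := hne nofun
    cases ht.1 hu with
    | bot => exact (h0 rfl).elim
    | nil => exact hb _ hu
  | left a =>
    obtain ⟨u, hu, h0⟩ := hne nofun
    cases ht.1 hu with
    | bot => exact (h0 rfl).elim
    | left h =>
      cases hb _ hu with
      | left h' =>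
        refine .left (ih' (S := {x | .left x ∈ T}) ⟨fun x hx => ?_, fun c hc => ?_⟩ fun x hx => ?_)
        · cases ht.1 hx; assumption
        · have : (.left a : Step D Cont) ≤ .left c := ht.2 fun u hu => by
            cases ht.1 hu with
            | bot => exact .bot _
            | left h => exact .left (hc hu)
          cases this; assumption
        · cases hb _ hx; assumption
  | right a =>
    obtain ⟨u, hu, h0⟩ := hne nofun
    cases ht.1 hu with
    | bot => exact (h0 rfl).elim
    | right h =>
      cases hb _ hu with
      | right h' =>
        refine .right
          (ih' (S := {x | .right x ∈ T}) ⟨fun x hx => ?_, fun c hc => ?_⟩ fun x hx => ?_)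
        · cases ht.1 hx; assumption
        · have : (.right a : Step D Cont) ≤ .right c := ht.2 fun u hu => by
            cases ht.1 hu with
            | bot => exact .bot _
            | right h => exact .right (hc hu)
          cases this; assumption
        · cases hb _ hx; assumption
  | pair a a' =>
    obtain ⟨u, hu, h0⟩ := hne nofun
    cases ht.1 hu with
    | bot => exact (h0 rfl).elim
    | pair h k =>
      cases hb _ hu with
      | pair h' k' =>
        refine .pair
          (ih' (S := {x | ∃ y, .pair x y ∈ T}) ⟨fun x ⟨y, hx⟩ => ?_, fun c hc => ?_⟩
            fun x ⟨y, hx⟩ => ?_)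
          (ih' (S := {y | ∃ x, .pair x y ∈ T}) ⟨fun y ⟨x, hx⟩ => ?_, fun c hc => ?_⟩
            fun y ⟨x, hx⟩ => ?_)
        · cases ht.1 hx; assumption
        -- Keeping the second component at its supremum `a'` turns a bound `c` on first components
        -- into a bound on all of `T`.
        · have : (.pair a a' : Step D Cont) ≤ .pair c a' := ht.2 fun u hu => by
            cases ht.1 hu with
            | bot => exact .bot _
            | pair h k => exact .pair (hc ⟨_, hu⟩) k
          cases this; assumption
        · cases hb _ hx; assumption
        · cases ht.1 hx; assumption
        · have : (.pair a a' : Step D Cont) ≤ .pair a c := ht.2 fun u hu => by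
            cases ht.1 hu with
            | bot => exact .bot _
            | pair h k => exact .pair h (hc ⟨_, hu⟩)
          cases this; assumption
        · cases hb _ hx; assumption
  | fn f =>
    obtain ⟨u, hu, h0⟩ := hne nofun
    cases ht.1 hu with
    | bot => exact (h0 rfl).elim
    | fn h =>
      cases hb _ hu with
      | fn h' =>
        have hf : IsLUB {g | .fn g ∈ T} f := by
          refine ⟨fun g hg => ?_, fun g hg => ?_⟩
          · cases ht.1 hg; assumption
          · have : (.fn f : Step D Cont) ≤ .fn g := ht.2 fun u hu => by
              cases ht.1 hu with
              | bot => exact .bot _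
              | fn h => exact .fn (hg hu)
            cases this; assumption
        -- Suprema of continuous functions are pointwise, so the inductive hypothesis is applied to
        -- the values at `trunc n a`.
        refine .fn fun a => ih' (isLUB_apply hf (trunc n a)) ?_
        rintro _ ⟨g, hg, rfl⟩
        cases hb _ hg with
        | fn h => exact h a

/-- Truncation preserves all existing suprema. -/
theorem isLUB_trunc (n : ℕ) {S : Set D} {s : D} (hs : IsLUB S s) :
    IsLUB (trunc n '' S) (trunc n s) := by
  induction n generalizing S s with
  | zero => exact ⟨by rintro _ ⟨x, -, rfl⟩; exact le_rfl, fun b _ => (bot_le : (⊥ : D) ≤ b)⟩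
  | succ n ih =>
    refine ⟨?_, fun b hb => ?_⟩
    · rintro _ ⟨x, hx, rfl⟩
      exact trunc_mono _ (hs.1 hx)
    · obtain ⟨t, rfl⟩ := roll_surjective s
      obtain ⟨b, rfl⟩ := roll_surjective b
      rw [trunc_succ_roll]
      refine roll_mono (isLUB_truncStep ih (isLUB_preimage_roll hs) fun u hu => ?_)
      have := hb ⟨_, hu, rfl⟩
      rw [trunc_succ_roll] at this
      exact le_of_roll_le this

end D

open D

/-! ### Inclusion of subdomains up to a finite stage -/

namespace Subdomain

/-- The preimage of a subdomain under truncation. -/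
def truncPreimage (n : ℕ) (X : Subdomain) : Subdomain where
  carrier := {x | trunc n x ∈ X}
  lower' _ hx _ h := X.lower hx (trunc_mono n h)
  sup' S hS _ s hs := X.sup_mem (S := trunc n '' S)
    (by rintro _ ⟨x, hx, rfl⟩; exact hS hx) (isLUB_trunc n hs)

/-- `X` is contained in `Y` up to the `n`-th approximation. -/
def LeAt (n : ℕ) (X Y : Subdomain) : Prop := ∀ x ∈ X, trunc n x ∈ Y

theorem leAt_of_subset {X Y : Subdomain} (h : (X : Set D) ⊆ Y) (n : ℕ) : LeAt n X Y :=
  fun x hx => Y.lower (h hx) (trunc_le n x)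

theorem LeAt.of_le {n m : ℕ} {X Y : Subdomain} (h : LeAt m X Y) (hnm : n ≤ m) : LeAt n X Y :=
  fun x hx => Y.lower (h x hx) (trunc_le_trunc hnm x)

theorem leAt_zero (X Y : Subdomain) : LeAt 0 X Y := fun _ _ => Y.bot_mem

/-- Each `x` is the supremum of its truncations, all of which lie in `Y`. -/
theorem subset_of_leAt {X Y : Subdomain} (h : ∀ n, LeAt n X Y) : (X : Set D) ⊆ Y := fun x hx =>
  Y.sup_mem (by rintro _ ⟨n, rfl⟩; exact h n x hx) (isLUB_emb_proj x)

theorem trunc_bot_mem (n : ℕ) (X : Subdomain) : trunc n ⊥ ∈ X := by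
  rw [trunc_bot]
  exact X.bot_mem

theorem LeAt.sum {n : ℕ} {X X' Y Y' : Subdomain} (hX : LeAt n X X') (hY : LeAt n Y Y') :
    LeAt (n + 1) (X.sum Y) (X'.sum Y') := by
  rintro _ ((⟨a, ha, rfl⟩ | ⟨a, ha, rfl⟩) | rfl)
  · exact Or.inl (Or.inl ⟨_, hX a ha, (trunc_succ_roll n (.left a)).symm⟩)
  · exact Or.inl (Or.inr ⟨_, hY a ha, (trunc_succ_roll n (.right a)).symm⟩)
  · exact trunc_bot_mem _ _

theorem LeAt.prod {n : ℕ} {X X' Y Y' : Subdomain} (hX : LeAt n X X') (hY : LeAt n Y Y') :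
    LeAt (n + 1) (X.prod Y) (X'.prod Y') := by
  rintro _ (⟨a, ha, b, hb, rfl⟩ | rfl)
  · exact Or.inl ⟨_, hX a ha, _, hY b hb, trunc_succ_roll n (.pair a b)⟩
  · exact trunc_bot_mem _ _

/-- The argument side is kept fixed; strict positivity ensures that this suffices. -/
theorem LeAt.arrow {n : ℕ} (X : Subdomain) {Y Y' : Subdomain} (hY : LeAt n Y Y') :
    LeAt (n + 1) (X.arrow Y) (X.arrow Y') := by
  rintro _ (⟨f, hf, rfl⟩ | rfl)
  -- The inner truncation keeps arguments in `X` by downward closure; the outer one lands in `Y'` by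
  -- `hY`.
  · exact Or.inl ⟨truncCont n f, fun a ha => hY _ (hf _ (X.lower ha (trunc_le n a))),
      trunc_succ_roll n (.fn f)⟩
  · exact trunc_bot_mem _ _

theorem inter_subset {F : Set Subdomain} {X : Subdomain} (h : X ∈ F) :
    (inter F : Set D) ⊆ X := fun _ hx => Set.mem_iInter₂.1 hx X h

theorem subset_inter {F : Set Subdomain} {s : Set D} (h : ∀ X ∈ F, s ⊆ X) :
    s ⊆ inter F := fun _ hx => Set.mem_iInter₂.2 fun X hX => h X hX hx

end Subdomain

/-! ### Stagewise comparison of type values -/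

namespace Ty

open Subdomain Function

theorem val_congr {ρ : Ty} {ζ ζ' : ℕ → Subdomain} (h : ∀ γ, Free γ ρ → ζ γ = ζ' γ) :
    ρ.val ζ = ρ.val ζ' := by
  induction ρ generalizing ζ ζ' with
  | var α => exact h α rfl
  | one => rfl
  | sum ρ σ ihρ ihσ | prod ρ σ ihρ ihσ | arrow ρ σ ihρ ihσ =>
    rw [val, val, ihρ fun γ hγ => h γ (Or.inl hγ), ihσ fun γ hγ => h γ (Or.inr hγ)]
  | fix β σ ih =>
    rw [val, val]
    congr 2
    funext Z
    rw [ih (ζ := update ζ β Z) (ζ' := update ζ' β Z) fun γ hγ => ?_]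
    by_cases hβ : γ = β
    · subst hβ; simp
    · simpa [hβ] using h γ ⟨Ne.symm hβ, hγ⟩

/-- If every variable in which two environments differ is strictly positive, and the environments
are comparable up to stage `n`, or, for variables that are not at the head, only up to all earlier
stages, then the values of the type are comparable up to stage `n`. -/
theorem leAt_val {ρ : Ty} (hwf : ρ.WellFormed) {n : ℕ} {ζ ζ' : ℕ → Subdomain}
    (hpos : ∀ γ, ζ γ = ζ' γ ∨ StrictlyPositive γ ρ) (hlt : ∀ γ, ∀ k < n, LeAt k (ζ γ) (ζ' γ))
    (hn : ∀ γ, LeAt n (ζ γ) (ζ' γ) ∨ ¬ IsFixChain γ ρ) : LeAt n (ρ.val ζ) (ρ.val ζ') := by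
  induction ρ generalizing n ζ ζ' with
  -- A bare variable is its own head, so comparability at stage `n` itself is available.
  | var α => exact (hn α).resolve_right fun h => h rfl
  | one => exact leAt_of_subset subset_rfl n
  | sum ρ σ ihρ ihσ =>
    cases n with
    | zero => exact leAt_zero _ _
    | succ k =>
      -- The summands are compared only at stage `k < n`, where `hlt` covers every variable, at the
      -- head or not.
      have hlt' : ∀ γ, ∀ j < k, LeAt j (ζ γ) (ζ' γ) := fun γ j hj => hlt γ j (by omega)
      exact (ihρ hwf.1 (fun γ => (hpos γ).imp_right And.left) hlt'
        fun γ => Or.inl (hlt γ k k.lt_succ_self)).sum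
        (ihσ hwf.2 (fun γ => (hpos γ).imp_right And.right) hlt'
        fun γ => Or.inl (hlt γ k k.lt_succ_self))
  | prod ρ σ ihρ ihσ =>
    cases n with
    | zero => exact leAt_zero _ _
    | succ k =>
      have hlt' : ∀ γ, ∀ j < k, LeAt j (ζ γ) (ζ' γ) := fun γ j hj => hlt γ j (by omega)
      exact (ihρ hwf.1 (fun γ => (hpos γ).imp_right And.left) hlt'
        fun γ => Or.inl (hlt γ k k.lt_succ_self)).prod
        (ihσ hwf.2 (fun γ => (hpos γ).imp_right And.right) hlt'
        fun γ => Or.inl (hlt γ k k.lt_succ_self))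
  | arrow ρ σ ihρ ihσ =>
    cases n with
    | zero => exact leAt_zero _ _
    | succ k =>
      -- By strict positivity, variables on which the environments differ are not free to the left
      -- of the arrow.
      have hρ : ρ.val ζ = ρ.val ζ' :=
        val_congr fun γ hγ => (hpos γ).resolve_right fun h => h.1 hγ
      rw [val, val, hρ]
      exact LeAt.arrow _ (ihσ hwf.2 (fun γ => (hpos γ).imp_right And.right)
        (fun γ j hj => hlt γ j (by omega)) fun γ => Or.inl (hlt γ k k.lt_succ_self))
  | fix β σ ih =>
    -- By minimality of the left-hand `fix`, it is enough that this preimage is a pre-fixed point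
    -- for `ζ`.
    suffices h : ((fix β σ).val ζ : Set D) ⊆ truncPreimage n ((fix β σ).val ζ') from
      fun x hx => h hx
    set Z' := (fix β σ).val ζ'
    -- That `Z'` is a pre-fixed point requires monotonicity of `σ` in `β`, obtained from the
    -- inductive hypothesis at all stages.
    have hZ' : (σ.val (update ζ' β Z') : Set D) ⊆ Z' := by
      refine subset_inter fun Y hY => Set.Subset.trans ?_ hY
      have hsub : ∀ m γ, LeAt m (update ζ' β Z' γ) (update ζ' β Y γ) := fun m γ => by
        rcases eq_or_ne γ β with rfl | hγ
        · rw [update_self, update_self]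
          exact leAt_of_subset (inter_subset hY) m
        · simpa [hγ] using leAt_of_subset subset_rfl m
      refine subset_of_leAt fun m => ih hwf.2 (fun γ => ?_) (fun γ k _ => hsub k γ)
        fun γ => Or.inl (hsub m γ)
      rcases eq_or_ne γ β with rfl | hγ
      · exact Or.inr hwf.1
      · simp [hγ]
    have hW : LeAt n (truncPreimage n Z') Z' := fun _ hx => hx
    -- For the bound variable, stage `n` holds by construction (`hW`), even if `β` is at the head of
    -- `σ`; for the others, being at the head of `fix β σ` and of `σ` coincide.
    refine inter_subset fun x hx => hZ' (ih hwf.2 (fun γ => ?_) (fun γ k hk => ?_) (fun γ => ?_) x hx)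
    all_goals rcases eq_or_ne γ β with rfl | hγ
    · exact Or.inr hwf.1
    · simpa [hγ] using (hpos γ).imp_right fun h => h.resolve_left hγ.symm
    · simpa using hW.of_le hk.le
    · simpa [hγ] using hlt γ k hk
    · simpa using Or.inl hW
    · simpa [hγ] using (hn γ).imp_right fun h h' => h ⟨hγ.symm, h'⟩

/-! ### Monotonicity, the fixed-point equation and uniqueness -/

variable {α : ℕ} {ρ : Ty}

theorem val_update_mono (hwf : (fix α ρ).WellFormed) (ζ : ℕ → Subdomain) {X Y : Subdomain}
    (h : (X : Set D) ⊆ Y) : (ρ.val (update ζ α X) : Set D) ⊆ ρ.val (update ζ α Y) := by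
  have hsub : ∀ m γ, LeAt m (update ζ α X γ) (update ζ α Y γ) := fun m γ => by
    rcases eq_or_ne γ α with rfl | hγ
    · simpa using leAt_of_subset h m
    · simpa [hγ] using leAt_of_subset subset_rfl m
  refine subset_of_leAt fun m => leAt_val hwf.2 (fun γ => ?_) (fun γ k _ => hsub k γ)
    fun γ => Or.inl (hsub m γ)
  rcases eq_or_ne γ α with rfl | hγ
  · exact Or.inr hwf.1
  · simp [hγ]

theorem val_fix_subset {ζ : ℕ → Subdomain} {X : Subdomain}
    (h : (ρ.val (update ζ α X) : Set D) ⊆ X) : ((fix α ρ).val ζ : Set D) ⊆ X :=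
  inter_subset h

theorem val_update_val_fix_subset (hwf : (fix α ρ).WellFormed) (ζ : ℕ → Subdomain) :
    (ρ.val (update ζ α ((fix α ρ).val ζ)) : Set D) ⊆ (fix α ρ).val ζ :=
  subset_inter fun _ hY => (val_update_mono hwf ζ (val_fix_subset hY)).trans hY

/-- The Knaster–Tarski argument: by monotonicity, applying the operator to the least pre-fixed point
gives another pre-fixed point. -/
theorem val_update_val_fix (hwf : (fix α ρ).WellFormed) (ζ : ℕ → Subdomain) :
    ρ.val (update ζ α ((fix α ρ).val ζ)) = (fix α ρ).val ζ :=
  SetLike.coe_injective <| (val_update_val_fix_subset hwf ζ).antisymm <|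
    val_fix_subset (val_update_mono hwf ζ (val_update_val_fix_subset hwf ζ))

/-- For a type without `α` at its head, every post-fixed point is below every pre-fixed point. -/
theorem subset_of_subset_val_of_val_subset (hwf : (fix α ρ).WellFormed) (hα : ¬ IsFixChain α ρ)
    {ζ : ℕ → Subdomain} {X Y : Subdomain} (hX : (X : Set D) ⊆ ρ.val (update ζ α X))
    (hY : (ρ.val (update ζ α Y) : Set D) ⊆ Y) : (X : Set D) ⊆ Y := by
  refine subset_of_leAt fun n => ?_
  induction n using Nat.strong_induction_on with
  | _ n ih =>
    -- Since `α` is not at the head of `ρ`, only `LeAt k X Y` for `k < n` is needed, which is the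
    -- inductive hypothesis.
    refine fun x hx => hY (leAt_val (n := n) hwf.2 (fun γ => ?_) (fun γ k hk => ?_) (fun γ => ?_) x (hX hx))
    all_goals rcases eq_or_ne γ α with rfl | hγ
    · exact Or.inr hwf.1
    · simp [hγ]
    · simpa using ih k hk
    · simpa [hγ] using leAt_of_subset subset_rfl k
    · exact Or.inr hα
    · simpa [hγ] using Or.inl (leAt_of_subset subset_rfl n)

theorem subset_val_fix (hwf : (fix α ρ).WellFormed) (hα : ¬ IsFixChain α ρ)
    {ζ : ℕ → Subdomain} {X : Subdomain} (hX : (X : Set D) ⊆ ρ.val (update ζ α X)) :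
    (X : Set D) ⊆ (fix α ρ).val ζ :=
  subset_of_subset_val_of_val_subset hwf hα hX (val_update_val_fix_subset hwf ζ)

end Ty

end Realizers

theorem theorem3p1 (α : ℕ) (ρ : Realizers.Ty)
    (hwf : (Realizers.Ty.fix α ρ).WellFormed) (hreg : (Realizers.Ty.fix α ρ).Regular)
    (ζ : ℕ → Realizers.Subdomain) (X : Realizers.Subdomain) :
    ((X : Set Realizers.D) ⊆ ρ.val (Function.update ζ α X) →
      (X : Set Realizers.D) ⊆ (Realizers.Ty.fix α ρ).val ζ) ∧
    ((ρ.val (Function.update ζ α X) : Set Realizers.D) ⊆ X →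
      ((Realizers.Ty.fix α ρ).val ζ : Set Realizers.D) ⊆ X) ∧
    (X = ρ.val (Function.update ζ α X) ↔ X = (Realizers.Ty.fix α ρ).val ζ) := by
  refine ⟨Realizers.Ty.subset_val_fix hwf hreg.1, Realizers.Ty.val_fix_subset, fun h => ?_, ?_⟩
  · have h' := congrArg (fun Y : Realizers.Subdomain => (Y : Set Realizers.D)) h
    exact SetLike.coe_injective <| (Realizers.Ty.subset_val_fix hwf hreg.1 h'.subset).antisymm
      (Realizers.Ty.val_fix_subset h'.superset)
  · rintro rfl
    exact (Realizers.Ty.val_update_val_fix hwf ζ).symm
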